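/- All graphs are finite and simple. Disks are taken in the hyperbolic plane. A graph $G$ is a \emph{strongly hyperbolic uniform disk graph (SHUDG) with disk radius $R>0$} if its vertices can be assigned points of the hyperbolic plane, all at distance at most $2R$ from one common point (the origin), such that two distinct vertices are adjacent if and only if the disks of radius $R$ around their points intersect (equivalently, their points have distance at most $2R$). Write $\omega(G)$ for the clique number and $\mathrm{tw}(G)$ for the treewidth of $G$. The \emph{row-treewidth} $\mathrm{rtw}(G)$ is the smallest $t$ such that $G$ is isomorphic to a (not necessarily induced) subgraph of the strong product $H\boxtimes P$ for some graph $H$ with $\mathrm{tw}(H)=t$ and some path $P$. Let $r:\mathbb N\to\mathbb R$ satisfy $r(n)\in\Omega(\log n)$, i.e., there is $c>0$ with $r(n)\ge c\log n$ for all sufficiently large $n$. Then: 1. There is a family $(G_n)_{n\in\mathbb N}$, where $G_n$ is an $n$-vertex SHUDG with disk radius $R_n$, such that $R_n\in\Theta(r(n))$, $\omega(G_n)\in O(\log\log n)$, $\mathrm{tw}(G_n)\in\Omega(\log n)$ and $\mathrm{rtw}(G_n)\in\Omega(\log n)$. 2. There is a family $(G'_n)_{n\in\mathbb N}$, where $G'_n$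 is an $n$-vertex SHUDG with disk radius $R'_n$, such that $R'_n\in\Theta(r(n))$, $\omega(G'_n)\in O(1)$, $\mathrm{tw}(G'_n)\in\Omega(\log\log n)$ and $\mathrm{rtw}(G'_n)\in\Omega(\log\log n)$. Here $O$, $\Omega$ and $\Theta$ refer to $n\to\infty$, with positive constants that may depend on the function $r$. -/

import Mathlib

namespace DiskGraph

/-! ### Treewidth -/

/-- A tree decomposition of `G`: a finite tree `tree` with a finite set of vertices of `G` (a bag)
at each node, such that every vertex and every edge of `G` lies in some bag, and such that the
nodes whose bags contain a given vertex induce a connected subgraph of the tree. -/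
structure TreeDecomposition {V : Type*} (G : SimpleGraph V) where
  size : ℕ
  tree : SimpleGraph (Fin size)
  isTree : tree.IsTree
  bag : Fin size → Finset V
  vertex_mem : ∀ v, ∃ i, v ∈ bag i
  edge_mem : ∀ u v, G.Adj u v → ∃ i, u ∈ bag i ∧ v ∈ bag i
  connected : ∀ v, (tree.induce {i | v ∈ bag i}).Connected

/-- The width of a tree decomposition: the largest size of a bag, minus one. (For the graph without
vertices, and only there, the subtraction may truncate.) -/
def TreeDecomposition.width {V : Type*} {G : SimpleGraph V} (D : TreeDecomposition G) : ℕ :=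
  (Finset.univ.sup fun i => (D.bag i).card) - 1

/-- The treewidth of a finite graph: the smallest width of a tree decomposition. -/
noncomputable def treewidth {V : Type*} (G : SimpleGraph V) : ℕ :=
  sInf {w | ∃ D : TreeDecomposition G, D.width = w}

/-- A finite graph has a tree decomposition, namely one with a single bag. -/
theorem nonempty_treeDecomposition {V : Type*} [Fintype V] (G : SimpleGraph V) :
    Nonempty (TreeDecomposition G) :=
  ⟨{ size := 1
     tree := ⊥
     isTree := SimpleGraph.IsTree.of_subsingleton
     bag := fun _ => Finset.univ
     vertex_mem := fun v => ⟨0, Finset.mem_univ v⟩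
     edge_mem := fun u v _ => ⟨0, Finset.mem_univ u, Finset.mem_univ v⟩
     connected := fun v =>
      { preconnected := fun a b => by rw [Subsingleton.elim a b]
        nonempty := ⟨⟨0, Finset.mem_univ v⟩⟩ } }⟩

/-! ### Row-treewidth -/

/-- The strong product of two graphs. -/
def strongProduct {α β : Type*} (G : SimpleGraph α) (H : SimpleGraph β) :
    SimpleGraph (α × β) where
  Adj u v := (u.1 = v.1 ∧ H.Adj u.2 v.2) ∨ (u.2 = v.2 ∧ G.Adj u.1 v.1) ∨
    (G.Adj u.1 v.1 ∧ H.Adj u.2 v.2)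
  symm := ⟨fun _ _ h => by
    rcases h with ⟨h, h'⟩ | ⟨h, h'⟩ | ⟨h, h'⟩
    · exact Or.inl ⟨h.symm, h'.symm⟩
    · exact Or.inr (Or.inl ⟨h.symm, h'.symm⟩)
    · exact Or.inr (Or.inr ⟨h.symm, h'.symm⟩)⟩
  loopless := ⟨fun _ h => by
    rcases h with ⟨_, h⟩ | ⟨_, h⟩ | ⟨h, _⟩ <;> exact h.ne rfl⟩

/-- The row-treewidth of a finite graph `G`: the smallest treewidth of a finite graph `H` such that
`G` is (isomorphic to) a subgraph, not necessarily induced, of the strong product of `H` and a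
path. -/
noncomputable def rowTreewidth {V : Type*} (G : SimpleGraph V) : ℕ :=
  sInf {t | ∃ (k m : ℕ) (H : SimpleGraph (Fin k)), treewidth H = t ∧
    G.IsContained (strongProduct H (SimpleGraph.pathGraph m))}

/-! ### Hyperbolic uniform disk graphs

The hyperbolic plane is the upper half-plane `UpperHalfPlane` with its hyperbolic metric, in which
`Metric.closedBall p r` is the disk of radius `r` around `p`. -/

/-- The disks of radius `r` around the positions `p v` represent `G`: two distinct vertices are
adjacent if and only if their disks intersect. -/
def Represents {V : Type*} (G : SimpleGraph V) (r : ℝ) (p : V → UpperHalfPlane) : Prop :=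
  ∀ u v, G.Adj u v ↔ u ≠ v ∧ (Metric.closedBall (p u) r ∩ Metric.closedBall (p v) r).Nonempty

/-- `G` is a strongly hyperbolic uniform disk graph with disk radius `r`: it is the intersection
graph of disks of radius `r > 0` in the hyperbolic plane whose centers all have distance at
most `2 * r` from one point (the origin `o`). -/
def IsSHUDG {V : Type*} (G : SimpleGraph V) (r : ℝ) : Prop :=
  0 < r ∧ ∃ (p : V → UpperHalfPlane) (o : UpperHalfPlane),
    Represents G r p ∧ ∀ v, dist o (p v) ≤ 2 * r

/-- Any two points of the hyperbolic plane have a midpoint. -/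
theorem exists_midpoint (z w : UpperHalfPlane) :
    ∃ m : UpperHalfPlane, dist z m = dist z w / 2 ∧ dist w m = dist z w / 2 := by
  have key : ∀ z w m : UpperHalfPlane, Real.cosh (dist z m) ^ 2 = (1 + Real.cosh (dist z w)) / 2 →
      dist z m = dist z w / 2 := by
    intro z w m h
    have h2 : Real.cosh (dist z w) = 2 * Real.cosh (dist z w / 2) ^ 2 - 1 := by
      have := Real.cosh_two_mul (dist z w / 2)
      rw [mul_div_cancel₀ _ two_ne_zero] at this
      rw [this, Real.sinh_sq]; ring
    have h3 : Real.cosh (dist z m) = Real.cosh (dist z w / 2) := by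
      rw [← sq_eq_sq₀ (Real.cosh_pos _).le (Real.cosh_pos _).le, h, h2]; ring
    have h4 := Real.cosh_le_cosh.1 h3.le
    have h5 := Real.cosh_le_cosh.1 h3.ge
    have e1 : |dist z m| = dist z m := abs_of_nonneg dist_nonneg
    have e2 : |dist z w / 2| = dist z w / 2 := abs_of_nonneg (by positivity)
    rw [e1, e2] at h4 h5
    exact le_antisymm h4 h5
  obtain ⟨a, ha⟩ : ∃ a, a = z.re := ⟨_, rfl⟩
  obtain ⟨b, hb⟩ : ∃ b, b = z.im := ⟨_, rfl⟩
  obtain ⟨c, hc⟩ : ∃ c, c = w.re := ⟨_, rfl⟩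
  obtain ⟨d, hd⟩ : ∃ d, d = w.im := ⟨_, rfl⟩
  have hb0 : 0 < b := hb ▸ z.im_pos
  have hd0 : 0 < d := hd ▸ w.im_pos
  -- the midpoint has real part `(a * d + c * b) / (b + d)` and imaginary part `y`
  obtain ⟨y, hy⟩ : ∃ y, y = √(b * d * ((a - c) ^ 2 + (b + d) ^ 2)) / (b + d) := ⟨_, rfl⟩
  have hq : 0 < b * d * ((a - c) ^ 2 + (b + d) ^ 2) := by positivity
  have hy0 : 0 < y := by rw [hy]; positivity
  have hy2 : y ^ 2 = b * d * ((a - c) ^ 2 + (b + d) ^ 2) / (b + d) ^ 2 := by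
    rw [hy, div_pow, Real.sq_sqrt hq.le]
  refine ⟨⟨⟨(a * d + c * b) / (b + d), y⟩, hy0⟩, key _ _ _ ?_, ?_⟩
  · rw [UpperHalfPlane.cosh_dist', UpperHalfPlane.cosh_dist', ← ha, ← hb, ← hc, ← hd]
    change ((((a - (a * d + c * b) / (b + d)) ^ 2 + b ^ 2 + y ^ 2)) / (2 * b * y)) ^ 2 = _
    rw [div_pow, mul_pow, hy2]
    field_simp
    ring
  · rw [dist_comm z w]
    apply key
    rw [UpperHalfPlane.cosh_dist', UpperHalfPlane.cosh_dist', ← ha, ← hb, ← hc, ← hd]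
    change ((((c - (a * d + c * b) / (b + d)) ^ 2 + d ^ 2 + y ^ 2)) / (2 * d * y)) ^ 2 = _
    rw [div_pow, mul_pow, hy2]
    field_simp
    ring

/-- Two disks of radius `r` intersect if and only if their centers have distance at most `2 * r`. -/
theorem disks_inter_nonempty_iff (z w : UpperHalfPlane) (r : ℝ) :
    (Metric.closedBall z r ∩ Metric.closedBall w r).Nonempty ↔ dist z w ≤ 2 * r := by
  constructor
  · rintro ⟨m, hz, hw⟩
    rw [Metric.mem_closedBall] at hz hw
    linarith [dist_triangle_left z w m]
  · intro h
    obtain ⟨m, hz, hw⟩ := exists_midpoint z w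
    refine ⟨m, ?_, ?_⟩ <;> rw [Metric.mem_closedBall, dist_comm] <;> linarith

end DiskGraph

namespace DiskGraph

open SimpleGraph

/-! ### The Helly property of subtrees -/

/-! The origin is placed at height `n`, and each integer `x` with `0 < x < n` at real part `x` and
at a height proportional to a weight `w x`. For `R ≥ 4 * log n` the heights of the integers are at
most `1`, and adjacency between them is essentially `(x - y) ^ 2 ≤ w x * w y`
(`exists_weight_graph`). The weight is `2 ^ (e + 1)` if the 2-adic valuation `e` of `x` (its level)
belongs to a chosen set `L`; otherwise it is so small that `x` is adjacent to the origin only.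

Each level in `L` is connected, since its consecutive members are adjacent, and levels `j < i` touch
at `2 ^ i - 2 ^ j` and `2 ^ i`. So the levels form a clique minor, and the Helly property of
subtrees yields treewidth at least `L.card - 1` (`card_le_width_add_one`). The origin dominates, so
an embedding into `H ⊠ P` uses at most three consecutive layers; hence row-treewidth is at least
about a third of treewidth (`treewidth_add_one_le_of_dominating`).

Apart from the origin, a clique with at least two integers has at most two on each level, and its
levels `a < b < c` satisfy `2 * b ≤ a + c + 4` (`two_mul_le_of_dyadicClose`). With all levels below
`Nat.log 2 n` in `L`, this leaves `O(log log n)` levels in a clique. With `L` consisting of the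
levels `K - 4 ^ s`, where `K = Nat.log 2 n - 1`, no such triple exists, so cliques are bounded while
`L` still has order `log log n`. -/

/-- A set of vertices closed under taking paths between its members. -/
def PathClosed {V : Type*} (T : SimpleGraph V) (S : Set V) : Prop :=
  ∀ a ∈ S, ∀ b ∈ S, ∀ p : T.Walk a b, p.IsPath → ∀ x ∈ p.support, x ∈ S

theorem PathClosed.inter {V : Type*} {T : SimpleGraph V} {S S' : Set V} (h : PathClosed T S)
    (h' : PathClosed T S') : PathClosed T (S ∩ S') := fun a ha b hb p hp x hx =>
  ⟨h a ha.1 b hb.1 p hp x hx, h' a ha.2 b hb.2 p hp x hx⟩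

/-- In a forest, a set is closed under paths as soon as its members are joined by walks inside. -/
theorem pathClosed_of_walks {V : Type*} {T : SimpleGraph V} (hT : T.IsAcyclic) {S : Set V}
    (h : ∀ a ∈ S, ∀ b ∈ S, ∃ p : T.Walk a b, ∀ x ∈ p.support, x ∈ S) : PathClosed T S := by
  classical
  intro a ha b hb p hp x hx
  obtain ⟨q, hq⟩ := h a ha b hb
  have e : p = q.bypass :=
    congrArg Subtype.val ((hT.subsingleton_path a b).elim ⟨p, hp⟩ ⟨q.bypass, q.bypass_isPath⟩)
  rw [e] at hx
  exact hq x (q.support_bypass_subset_support hx)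

/-- A path from `A` to `B` passes through `A ∩ B` if `A`, `B` are intersecting subtrees. -/
theorem exists_mem_inter_of_path {V : Type*} {T : SimpleGraph V} (hT : T.IsTree) {A B : Set V}
    (hA : PathClosed T A) (hB : PathClosed T B) {a : V} (haA : a ∈ A) (haB : a ∈ B) :
    ∀ {c b : V} (s : T.Walk c b), s.IsPath → c ∈ A → b ∈ B → ∃ x ∈ s.support, x ∈ A ∧ x ∈ B := by
  classical
  intro c b s
  induction s with
  | nil => exact fun _ hc hb => ⟨_, by simp, hc, hb⟩
  | @cons c c' b hcc s ih =>
    intro hs hc hb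
    rw [Walk.cons_isPath_iff] at hs
    by_cases hc' : c' ∈ A
    · obtain ⟨x, hx, h⟩ := ih hs.1 hc' hb
      exact ⟨x, by simp [hx], h⟩
    · refine ⟨c, by simp, hc, ?_⟩
      -- Here the path leaves `A` after `c`, so the path from `c'` to `a` runs through `c`. Hence
      -- `c` also lies on the detour along `s` to `b` and then inside `B` to `a`; it is not on `s`,
      -- so it is in `B`.
      by_contra hcB
      obtain ⟨q, hq, -⟩ := hT.existsUnique_path c a
      obtain ⟨t, ht, -⟩ := hT.existsUnique_path b a
      have hq' : (Walk.cons hcc.symm q).IsPath :=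
        (Walk.cons_isPath_iff _ _).2 ⟨hq, fun h => hc' (hA c hc a haA q hq c' h)⟩
      have e : Walk.cons hcc.symm q = (s.append t).bypass := congrArg Subtype.val
        ((hT.isAcyclic.subsingleton_path c' a).elim ⟨_, hq'⟩
          ⟨(s.append t).bypass, Walk.bypass_isPath _⟩)
      have hmem : c ∈ (s.append t).support := by
        apply Walk.support_bypass_subset_support
        rw [← e]
        simp
      rw [Walk.mem_support_append_iff] at hmem
      rcases hmem with h | h
      · exact hs.2 h
      · exact hcB (hB b hb a haB t ht c h)

/-- Finitely many pairwise intersecting subtrees of a tree have a common node. -/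
theorem helly_subtrees {V ι : Type*} {T : SimpleGraph V} (hT : T.IsTree) (s : Finset ι)
    (hs : s.Nonempty) : ∀ F : ι → Set V, (∀ i, PathClosed T (F i)) →
      (∀ i ∈ s, ∀ j ∈ s, (F i ∩ F j).Nonempty) → ∃ x, ∀ i ∈ s, x ∈ F i := by
  induction hs using Finset.Nonempty.cons_induction with
  | singleton a =>
    intro F _ h
    obtain ⟨x, hx, -⟩ := h a (by simp) a (by simp)
    exact ⟨x, by simpa using hx⟩
  | cons j s hj hs ih =>
    intro F hF h
    -- Induction applies to the traces on `F j`. They meet pairwise: a path inside `F j` from `F i`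
    -- to `F i'` passes through `F i ∩ F i'`.
    obtain ⟨x, hx⟩ := ih (fun i => F i ∩ F j) (fun i => (hF i).inter (hF j)) (by
      intro i hi i' hi'
      obtain ⟨a, ha, ha'⟩ := h i (by simp [hi]) i' (by simp [hi'])
      obtain ⟨b, hb, hb'⟩ := h i' (by simp [hi']) j (by simp)
      obtain ⟨c, hc, hc'⟩ := h i (by simp [hi]) j (by simp)
      obtain ⟨p, hp, -⟩ := hT.existsUnique_path c b
      obtain ⟨x, hx, hxi, hxi'⟩ :=
        exists_mem_inter_of_path hT (hF i) (hF i') ha ha' p hp hc hb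
      have hxj := hF j c hc' b hb' p hp x hx
      exact ⟨x, ⟨hxi, hxj⟩, hxi', hxj⟩)
    refine ⟨x, fun i hi => ?_⟩
    rcases Finset.mem_cons.1 hi with rfl | hi
    · obtain ⟨k, hk⟩ := hs
      exact (hx k hk).2
    · exact (hx i hi).1

/-! ### Lower bounds for treewidth and row-treewidth -/

theorem exists_walk_of_induce_preconnected {V : Type*} {T : SimpleGraph V} {S : Set V}
    (h : (T.induce S).Preconnected) {a b : V} (ha : a ∈ S) (hb : b ∈ S) :
    ∃ p : T.Walk a b, ∀ x ∈ p.support, x ∈ S := by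
  obtain ⟨w⟩ := h ⟨a, ha⟩ ⟨b, hb⟩
  refine ⟨w.map (Embedding.induce S).toHom, fun x hx => ?_⟩
  obtain ⟨y, -, rfl⟩ : ∃ y ∈ w.support, (Embedding.induce S).toHom y = x :=
    List.mem_map.1 (Walk.support_map _ w ▸ hx)
  exact y.2

namespace TreeDecomposition

variable {V : Type*} {G : SimpleGraph V}

theorem card_bag_le (D : TreeDecomposition G) (i : Fin D.size) :
    (D.bag i).card ≤ D.width + 1 := by
  have : (D.bag i).card ≤ Finset.univ.sup fun i => (D.bag i).card :=
    Finset.le_sup (f := fun i => (D.bag i).card) (Finset.mem_univ i)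
  unfold width
  omega

/-- The nodes whose bags meet a connected set of vertices form a subtree. -/
theorem pathClosed_nodes (D : TreeDecomposition G) {A : Set V}
    (hA : (G.induce A).Preconnected) : PathClosed D.tree {i | ∃ v ∈ A, v ∈ D.bag i} := by
  refine pathClosed_of_walks D.isTree.isAcyclic ?_
  rintro i ⟨u, hu, hui⟩ j ⟨v, hv, hvj⟩
  have single : ∀ w ∈ A, ∀ i j, w ∈ D.bag i → w ∈ D.bag j →
      ∃ p : D.tree.Walk i j, ∀ x ∈ p.support, x ∈ {i | ∃ v ∈ A, v ∈ D.bag i} := by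
    intro w hw i j hi hj
    obtain ⟨p, hp⟩ := exists_walk_of_induce_preconnected (D.connected w).preconnected
      (show i ∈ {i | w ∈ D.bag i} from hi) (show j ∈ {i | w ∈ D.bag i} from hj)
    exact ⟨p, fun x hx => ⟨w, hw, hp x hx⟩⟩
  obtain ⟨w, hw⟩ := exists_walk_of_induce_preconnected hA hu hv
  clear hu hv
  induction w generalizing i with
  | nil => exact single _ (hw _ (by simp)) i j hui hvj
  | @cons u u' v huu w ih =>
    obtain ⟨k, hk, hk'⟩ := D.edge_mem u u' huu
    obtain ⟨p, hp⟩ := single u (hw _ (by simp)) i k hui hk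
    obtain ⟨q, hq⟩ := ih k hk' hvj (fun x hx => hw x (by simp [hx]))
    refine ⟨p.append q, fun x hx => ?_⟩
    rcases (Walk.mem_support_append_iff _ _).1 hx with h | h
    exacts [hp x h, hq x h]

/-- A graph with `m` disjoint connected pairwise touching vertex sets (a clique minor) has no tree
decomposition of width less than `m - 1`. -/
theorem card_le_width_add_one (D : TreeDecomposition G) {ι : Type*} (s : Finset ι)
    (A : ι → Set V) (hA : ∀ i, (G.induce (A i)).Preconnected)
    (hd : ∀ i j v, v ∈ A i → v ∈ A j → i = j)
    (hne : ∀ i ∈ s, (A i).Nonempty)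
    (ht : ∀ i ∈ s, ∀ j ∈ s, i ≠ j → ∃ u ∈ A i, ∃ v ∈ A j, G.Adj u v) :
    s.card ≤ D.width + 1 := by
  rcases s.eq_empty_or_nonempty with rfl | hs
  · simp
  obtain ⟨x, hx⟩ := helly_subtrees D.isTree s hs (fun i => {k | ∃ v ∈ A i, v ∈ D.bag k})
    (fun i => D.pathClosed_nodes (hA i)) (by
      intro i hi j hj
      by_cases hij : i = j
      · subst hij
        obtain ⟨v, hv⟩ := hne i hi
        obtain ⟨k, hk⟩ := D.vertex_mem v
        exact ⟨k, ⟨v, hv, hk⟩, v, hv, hk⟩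
      · obtain ⟨u, hu, v, hv, huv⟩ := ht i hi j hj hij
        obtain ⟨k, hk, hk'⟩ := D.edge_mem u v huv
        exact ⟨k, ⟨u, hu, hk⟩, v, hv, hk'⟩)
  have : Nonempty V := (hne _ hs.choose_spec).to_type
  choose! f hfA hfx using hx
  refine (Finset.card_le_card_of_injOn f hfx ?_).trans (D.card_bag_le x)
  intro i hi j hj hij
  refine hd i j (f i) (hfA i hi) ?_
  rw [hij]
  exact hfA j hj

end TreeDecomposition

theorem exists_width_eq_treewidth {V : Type*} [Fintype V] (G : SimpleGraph V) :
    ∃ D : TreeDecomposition G, D.width = treewidth G := by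
  obtain ⟨D⟩ := nonempty_treeDecomposition G
  exact Nat.sInf_mem (s := {w | ∃ D : TreeDecomposition G, D.width = w}) ⟨_, D, rfl⟩

/-- The treewidth of a graph with a dominating vertex is bounded by its row-treewidth. -/
theorem treewidth_add_one_le_of_dominating {n : ℕ} (G : SimpleGraph (Fin n)) (a : Fin n)
    (ha : ∀ v, v ≠ a → G.Adj a v) : treewidth G + 1 ≤ 3 * (rowTreewidth G + 1) := by
  have hne : {t | ∃ (k m : ℕ) (H : SimpleGraph (Fin k)), treewidth H = t ∧
      G.IsContained (strongProduct H (SimpleGraph.pathGraph m))}.Nonempty := by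
    -- `G` itself times a one-vertex path shows that the infimum is attained.
    refine ⟨_, n, 1, G, rfl, ⟨⟨⟨fun v => (v, 0), ?_⟩, ?_⟩⟩⟩
    · exact fun h => Or.inr (Or.inl ⟨rfl, h⟩)
    · exact fun u v h => congrArg Prod.fst h
  obtain ⟨k, m, H, hH, ⟨f⟩⟩ := Nat.sInf_mem hne
  change treewidth H = rowTreewidth G at hH
  obtain ⟨D, hD⟩ := exists_width_eq_treewidth H
  have hrow : ∀ v, (f v).2.val ≤ (f a).2.val + 1 ∧ (f a).2.val ≤ (f v).2.val + 1 := by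
    intro v
    by_cases hv : v = a
    · subst hv; omega
    · have hadj : (strongProduct H (pathGraph m)).Adj (f a) (f v) := f.toHom.map_adj (ha v hv)
      rcases hadj with ⟨-, h⟩ | ⟨h, -⟩ | ⟨-, h⟩
      · rw [pathGraph_adj] at h; omega
      · rw [h]; omega
      · rw [pathGraph_adj] at h; omega
  -- Pulling the bags of `D` back along the first coordinate of `f` enlarges them at most threefold,
  -- because only three layers occur.
  let E : TreeDecomposition G :=
    { size := D.size
      tree := D.tree
      isTree := D.isTree
      bag := fun i => Finset.univ.filter fun v => (f v).1 ∈ D.bag i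
      vertex_mem := fun v => by simpa using D.vertex_mem (f v).1
      edge_mem := fun u v h => by
        have hadj : (strongProduct H (pathGraph m)).Adj (f u) (f v) := f.toHom.map_adj h
        simp only [Finset.mem_filter, Finset.mem_univ, true_and]
        rcases hadj with ⟨h, -⟩ | ⟨-, h⟩ | ⟨h, -⟩
        · rw [h]; simpa using D.vertex_mem (f v).1
        · exact D.edge_mem _ _ h
        · exact D.edge_mem _ _ h
      connected := fun v => by
        have e : {i | v ∈ Finset.univ.filter fun v => (f v).1 ∈ D.bag i} =
            {i | (f v).1 ∈ D.bag i} := by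
          ext i; simp
        rw [e]
        exact D.connected (f v).1 }
  have hcard : ∀ i, (E.bag i).card ≤ 3 * (rowTreewidth G + 1) := by
    intro i
    have h1 : (E.bag i).card ≤
        (D.bag i ×ˢ Finset.Icc ((f a).2.val - 1) ((f a).2.val + 1)).card := by
      refine Finset.card_le_card_of_injOn (fun v => ((f v).1, (f v).2.val)) ?_ ?_
      · intro v hv
        have hv' : (f v).1 ∈ D.bag i := by simpa [E] using hv
        have := hrow v
        simp only [Finset.coe_product, Set.mem_prod, Finset.mem_coe, Finset.mem_Icc]
        exact ⟨hv', by omega, by omega⟩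
      · intro u _ v _ h
        simp only [Prod.mk.injEq] at h
        exact f.injective (Prod.ext h.1 (Fin.ext h.2))
    rw [Finset.card_product, Nat.card_Icc] at h1
    have h2 := D.card_bag_le i
    rw [hD, hH] at h2
    calc (E.bag i).card ≤ (D.bag i).card * ((f a).2.val + 1 + 1 - ((f a).2.val - 1)) := h1
      _ ≤ (rowTreewidth G + 1) * 3 := Nat.mul_le_mul h2 (by omega)
      _ = _ := by ring
  have hE : E.width + 1 ≤ 3 * (rowTreewidth G + 1) := by
    have : Finset.univ.sup (fun i => (E.bag i).card) ≤ 3 * (rowTreewidth G + 1) :=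
      Finset.sup_le fun i _ => hcard i
    unfold TreeDecomposition.width
    omega
  have : treewidth G ≤ E.width := Nat.sInf_le ⟨E, rfl⟩
  omega

/-! ### Cliques of dyadic levels -/

theorem padicValNat_two_pow_mul_odd (e a : ℕ) : padicValNat 2 (2 ^ e * (2 * a + 1)) = e := by
  rw [padicValNat.mul (by positivity) (by positivity), padicValNat.prime_pow,
    padicValNat.eq_zero_of_not_dvd (by omega), add_zero]

theorem exists_eq_two_pow_mul_odd {x : ℕ} (hx : x ≠ 0) :
    ∃ a, x = 2 ^ padicValNat 2 x * (2 * a + 1) := by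
  obtain ⟨e, k, ⟨a, rfl⟩, h⟩ := Nat.exists_eq_two_pow_mul_odd hx
  refine ⟨a, ?_⟩
  have : padicValNat 2 x = e := by
    rw [h, padicValNat_two_pow_mul_odd]
  rw [this]
  exact h

/-- The condition for two positive integers, of weights `2 ^ (v + 1)` with `v` the 2-adic
valuation, to be close relative to their weights. -/
def DyadicClose (x y : ℕ) : Prop :=
  ((x : ℤ) - y) ^ 2 ≤ 2 ^ (padicValNat 2 x + 1) * 2 ^ (padicValNat 2 y + 1)

/-- Integers on level `e` differ by multiples of `2 ^ (e + 1)`, and closeness allows a difference of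
at most `2 ^ (e + 1)`. So each level contributes only its least member and possibly the next one. -/
theorem card_le_two_mul_card_image_padicValNat {T : Finset ℕ} (h0 : 0 ∉ T)
    (hT : ∀ x ∈ T, ∀ y ∈ T, x ≠ y → DyadicClose x y) :
    T.card ≤ 2 * (T.image (padicValNat 2)).card := by
  refine Finset.card_le_mul_card_image _ _ fun e _ => ?_
  rcases (T.filter fun x => padicValNat 2 x = e).eq_empty_or_nonempty with h | h
  · rw [h]; simp
  obtain ⟨x₀, hx₀, hmin⟩ := Finset.exists_min_image _ id h
  rw [Finset.mem_filter] at hx₀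
  refine (Finset.card_le_card (t := {x₀, x₀ + 2 ^ (e + 1)}) fun x hx => ?_).trans
    Finset.card_le_two
  have hle : x₀ ≤ x := hmin x hx
  rw [Finset.mem_filter] at hx
  rw [Finset.mem_insert, Finset.mem_singleton]
  by_cases hne : x = x₀
  · exact Or.inl hne
  right
  have hc := hT x hx.1 x₀ hx₀.1 hne
  obtain ⟨a, ha⟩ := exists_eq_two_pow_mul_odd (x := x) (fun h => h0 (h ▸ hx.1))
  obtain ⟨b, hb⟩ := exists_eq_two_pow_mul_odd (x := x₀) (fun h => h0 (h ▸ hx₀.1))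
  unfold DyadicClose at hc
  rw [hx.2] at ha hc
  rw [hx₀.2] at hb hc
  have hp : (0 : ℤ) < 2 ^ (e + 1) := by positivity
  have h1 : ((x : ℤ) - x₀) ≤ 2 ^ (e + 1) := by nlinarith
  have h2 : (x : ℤ) - x₀ = 2 ^ (e + 1) * ((a : ℤ) - b) := by
    rw [ha, hb]; push_cast; ring
  have h3 : (a : ℤ) - b ≤ 1 := by
    by_contra hcon
    nlinarith
  have h4 : 0 < (a : ℤ) - b := by
    have : (0 : ℤ) < (x : ℤ) - x₀ := by omega
    rw [h2] at this
    exact pos_of_mul_pos_right this hp.le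
  have h5 : (a : ℤ) - b = 1 := by omega
  rw [h5] at h2
  zify
  linarith

/-- Distinct levels force `|y - z| ≥ 2 ^ v(y)`, where `v` is the valuation, while the detour through
`x` gives `|y - z| ^ 2 ≤ 4 * 2 ^ (v(x) + 1) * 2 ^ (v(z) + 1)`. -/
theorem two_mul_le_of_dyadicClose {x y z : ℕ} (hy : y ≠ 0) (hz : z ≠ 0)
    (hyz : padicValNat 2 y < padicValNat 2 z)
    (cxy : DyadicClose x y) (cxz : DyadicClose x z) :
    2 * padicValNat 2 y ≤ padicValNat 2 x + padicValNat 2 z + 4 := by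
  obtain ⟨a, ha⟩ := exists_eq_two_pow_mul_odd hy
  obtain ⟨b, hb⟩ := exists_eq_two_pow_mul_odd hz
  have hne : (y : ℤ) - z ≠ 0 := by
    intro h
    have : y = z := by omega
    rw [this] at hyz
    exact hyz.ne rfl
  unfold DyadicClose at cxy cxz
  generalize padicValNat 2 x = e at *
  generalize padicValNat 2 y = e' at *
  generalize padicValNat 2 z = e'' at *
  obtain ⟨d, rfl⟩ := Nat.exists_eq_add_of_lt hyz
  have h1 : (y : ℤ) - z = 2 ^ e' * (2 * a + 1 - 2 ^ (d + 1) * (2 * b + 1)) := by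
    rw [ha, hb]; push_cast; ring
  have h2 : ((2 : ℤ) ^ e') ^ 2 ≤ ((y : ℤ) - z) ^ 2 := by
    rw [h1, mul_pow]
    have hk : (2 * a + 1 - 2 ^ (d + 1) * (2 * b + 1) : ℤ) ≠ 0 := by
      rintro h
      rw [h, mul_zero] at h1
      exact hne h1
    have : (1 : ℤ) ≤ (2 * a + 1 - 2 ^ (d + 1) * (2 * b + 1) : ℤ) ^ 2 := by
      have := sq_pos_of_ne_zero hk
      omega
    nlinarith [sq_nonneg ((2 : ℤ) ^ e')]
  have h3 : ((y : ℤ) - z) ^ 2 ≤ 2 * ((x : ℤ) - y) ^ 2 + 2 * ((x : ℤ) - z) ^ 2 := by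
    nlinarith [sq_nonneg ((x : ℤ) - y + (x - z))]
  have h4 : (2 : ℤ) ^ (e + 1) * 2 ^ (e' + 1) ≤ 2 ^ (e + 1) * 2 ^ (e' + d + 1 + 1) :=
    mul_le_mul_of_nonneg_left (pow_le_pow_right₀ (by norm_num) (by omega)) (by positivity)
  have h5 : (2 : ℤ) ^ (2 * e') ≤ 2 ^ (e + (e' + d + 1) + 4) := by
    calc (2 : ℤ) ^ (2 * e') = (2 ^ e') ^ 2 := by rw [← pow_mul, mul_comm]
      _ ≤ 4 * (2 ^ (e + 1) * 2 ^ (e' + d + 1 + 1)) := by linarith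
      _ = _ := by ring
  exact (pow_le_pow_iff_right₀ (by norm_num : (1 : ℤ) < 2)).1 h5

/-- The differences to the least element of `E` roughly double, so `E` is logarithmically small. -/
theorem card_le_log_of_doubling {E : Finset ℕ} {K : ℕ} (hK : ∀ e ∈ E, e ≤ K)
    (hE : ∀ a ∈ E, ∀ b ∈ E, ∀ c ∈ E, a < b → b < c → 2 * b ≤ a + c + 4) :
    E.card ≤ Nat.log 2 K + 6 := by
  rcases E.eq_empty_or_nonempty with rfl | hne
  · simp
  obtain ⟨a, ha, hmin⟩ := Finset.exists_min_image E id hne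
  simp only [id] at hmin
  -- Measured from `a + 4`, the hypothesis reads `2 * (b - (a + 4)) ≤ c - (a + 4)`. From `a + 5` on
  -- these differences are positive, so their binary logarithms are distinct; at most five elements
  -- lie below.
  have hsplit := Finset.card_filter_add_card_filter_not (s := E) (fun e => e < a + 5)
  have h1 : (E.filter fun e => e < a + 5).card ≤ 5 := by
    refine (Finset.card_le_card (t := Finset.Ico a (a + 5)) fun e he => ?_).trans (by simp)
    rw [Finset.mem_filter] at he
    exact Finset.mem_Ico.2 ⟨hmin e he.1, he.2⟩
  have h2 : (E.filter fun e => ¬ e < a + 5).card ≤ (Finset.range (Nat.log 2 K + 1)).card := by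
    have key : ∀ b ∈ E, ∀ c ∈ E, a + 5 ≤ b → b < c →
        Nat.log 2 (b - (a + 4)) < Nat.log 2 (c - (a + 4)) := by
      intro b hb c hc hab hbc
      have h := hE a ha b hb c hc (by omega) hbc
      calc Nat.log 2 (b - (a + 4)) < Nat.log 2 ((b - (a + 4)) * 2) := by
            rw [Nat.log_mul_base (by norm_num) (by omega)]; omega
        _ ≤ _ := Nat.log_mono_right (by omega)
    refine Finset.card_le_card_of_injOn (fun e => Nat.log 2 (e - (a + 4))) ?_ ?_
    · intro e he
      have he' := Finset.mem_filter.1 he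
      have := hK e he'.1
      have h3 : Nat.log 2 (e - (a + 4)) ≤ Nat.log 2 K := Nat.log_mono_right (by omega)
      exact Finset.mem_coe.2 (Finset.mem_range.2 (Nat.lt_succ_of_le h3))
    · intro b hb c hc hbc
      have hb' := Finset.mem_filter.1 hb
      have hc' := Finset.mem_filter.1 hc
      rcases lt_trichotomy b c with h | h | h
      · exact absurd hbc (key b hb'.1 c hc'.1 (by omega) h).ne
      · exact h
      · exact absurd hbc (key c hc'.1 b hb'.1 (by omega) h).ne'
  rw [Finset.card_range] at h2
  omega

theorem card_le_two_of_no_lt_lt {E : Finset ℕ}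
    (hE : ∀ a ∈ E, ∀ b ∈ E, ∀ c ∈ E, a < b → b < c → False) : E.card ≤ 2 := by
  rcases E.eq_empty_or_nonempty with rfl | hne
  · simp
  refine (Finset.card_le_card (t := {E.min' hne, E.max' hne}) fun e he => ?_).trans
    Finset.card_le_two
  rw [Finset.mem_insert, Finset.mem_singleton]
  by_contra! h
  exact hE _ (E.min'_mem hne) e he _ (E.max'_mem hne)
    (lt_of_le_of_ne (E.min'_le e he) h.1.symm) (lt_of_le_of_ne (E.le_max' e he) h.2)

/-! ### The disk graph of a set of dyadic levels -/

/-- This compares `cosh (dist z w) = 1 + |z - w| ^ 2 / (2 * z.im * w.im)` with `cosh (2 * R) = 1 + 2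
* sinh R ^ 2`. -/
theorem dist_le_two_mul_iff (z w : UpperHalfPlane) {R : ℝ} (hR : 0 ≤ R) :
    dist z w ≤ 2 * R ↔
      (z.re - w.re) ^ 2 + (z.im - w.im) ^ 2 ≤ z.im * w.im * (2 * Real.sinh R) ^ 2 := by
  have hz := z.im_pos
  have hw := w.im_pos
  have h : dist z w ≤ 2 * R ↔ Real.cosh (dist z w) ≤ Real.cosh (2 * R) := by
    rw [Real.cosh_le_cosh, abs_of_nonneg dist_nonneg, abs_of_nonneg (by linarith)]
  rw [h, UpperHalfPlane.cosh_dist', Real.cosh_two_mul, Real.cosh_sq, div_le_iff₀ (by positivity)]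
  constructor <;> intro h <;> nlinarith

/-- The weight of a positive integer: determined by the 2-adic valuation if that belongs to `L`,
and negligible otherwise. -/
noncomputable def weight (L : Finset ℕ) (n x : ℕ) : ℝ :=
  if padicValNat 2 x ∈ L then 2 ^ (padicValNat 2 x + 1) else 1 / (4 * n)

theorem weight_of_mem {L : Finset ℕ} {n x : ℕ} (h : padicValNat 2 x ∈ L) :
    weight L n x = 2 ^ (padicValNat 2 x + 1) := if_pos h

theorem weight_le {L : Finset ℕ} {n : ℕ} (hn : 4 ≤ n) (hL : ∀ e ∈ L, 2 ^ e < n) (x : ℕ) :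
    weight L n x ≤ 2 * n := by
  have hn' : (4 : ℝ) ≤ n := by exact_mod_cast hn
  unfold weight
  split_ifs with h
  · have : (2 : ℝ) ^ padicValNat 2 x < n := by exact_mod_cast hL _ h
    rw [pow_succ]; linarith
  · rw [div_le_iff₀ (by positivity)]; nlinarith

theorem le_weight {L : Finset ℕ} {n : ℕ} (hn : 4 ≤ n) (x : ℕ) : 1 / (4 * n) ≤ weight L n x := by
  have hn' : (4 : ℝ) ≤ n := by exact_mod_cast hn
  unfold weight
  split_ifs with h
  · refine le_trans ?_ (one_le_pow₀ (by norm_num))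
    rw [div_le_iff₀ (by positivity)]; linarith
  · exact le_rfl

theorem weight_pos {L : Finset ℕ} {n : ℕ} (hn : 4 ≤ n) (x : ℕ) : 0 < weight L n x := by
  have hn' : (4 : ℝ) ≤ n := by exact_mod_cast hn
  exact lt_of_lt_of_le (by positivity) (le_weight hn x)

/-- There is a disk graph on `{0, …, n - 1}`, in which `0` (the origin) is dominating and the
adjacency of positive integers is governed by their weights. -/
theorem exists_weight_graph {n : ℕ} (hn : 4 ≤ n) {R : ℝ} (hR0 : 0 < R)
    (hR : 8 * (n : ℝ) ^ 2 ≤ 2 * Real.sinh R) {L : Finset ℕ} (hL : ∀ e ∈ L, 2 ^ e < n) :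
    ∃ G : SimpleGraph (Fin n), IsSHUDG G R ∧
      (∀ u v : Fin n, u.val = 0 → v.val ≠ 0 → G.Adj u v) ∧
      (∀ u v : Fin n, u.val ≠ 0 → v.val ≠ 0 → G.Adj u v →
        ((u.val : ℝ) - v.val) ^ 2 ≤ weight L n u * weight L n v) ∧
      (∀ u v : Fin n, u.val ≠ 0 → v.val ≠ 0 → u ≠ v → weight L n u = weight L n v →
        ((u.val : ℝ) - v.val) ^ 2 ≤ weight L n u * weight L n v → G.Adj u v) ∧
      (∀ u v : Fin n, u.val ≠ 0 → v.val ≠ 0 → u ≠ v →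
        ((u.val : ℝ) - v.val) ^ 2 + 1 ≤ weight L n u * weight L n v → G.Adj u v) := by
  have hn' : (4 : ℝ) ≤ n := by exact_mod_cast hn
  obtain ⟨m, hm⟩ : ∃ m, m = 2 * Real.sinh R := ⟨_, rfl⟩
  rw [← hm] at hR
  have hm0 : 0 < m := lt_of_lt_of_le (by positivity) hR
  let p : ℕ → UpperHalfPlane := fun x =>
    if x = 0 then ⟨⟨0, n⟩, by simp; omega⟩
    else ⟨⟨x, weight L n x / m⟩, div_pos (weight_pos hn x) hm0⟩
  have p0re : (p 0).re = 0 := rfl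
  have p0im : (p 0).im = n := rfl
  have pre : ∀ x, x ≠ 0 → (p x).re = x := fun x hx => by simp only [p, if_neg hx]; rfl
  have pim : ∀ x, x ≠ 0 → (p x).im = weight L n x / m := fun x hx => by
    simp only [p, if_neg hx]; rfl
  have small : ∀ x, weight L n x / m ≤ 1 := fun x => by
    rw [div_le_one hm0]
    have := weight_le hn hL x
    nlinarith
  have pos : ∀ x, 0 < weight L n x / m := fun x => div_pos (weight_pos hn x) hm0
  have cross : ∀ x y, weight L n x / m * (weight L n y / m) * m ^ 2 =
      weight L n x * weight L n y := fun x y => by field_simp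
  have apex : ∀ x, x < n → dist (p 0) (p x) ≤ 2 * R := by
    intro x hx
    by_cases hx0 : x = 0
    · subst hx0
      rw [_root_.dist_self]; linarith
    rw [dist_le_two_mul_iff _ _ hR0.le, p0re, p0im, pre x hx0, pim x hx0, ← hm]
    have hxn : (x : ℝ) ≤ n := by exact_mod_cast hx.le
    have h1 : ((0 : ℝ) - x) ^ 2 ≤ n ^ 2 := by
      rw [zero_sub, neg_sq]
      exact pow_le_pow_left₀ (by positivity) hxn 2
    have h2 : ((n : ℝ) - weight L n x / m) ^ 2 ≤ n ^ 2 := by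
      apply pow_le_pow_left₀ <;> linarith [small x, pos x]
    have h3 : (n : ℝ) * (weight L n x / m) * m ^ 2 = n * weight L n x * m := by field_simp
    have h4 : 1 / 4 ≤ n * weight L n x := by
      -- The default weight `1 / (4 * n)` is just large enough for the origin: the squared Euclidean
      -- distance is at most `2 * n ^ 2 ≤ m / 4 ≤ n * weight L n x * m`.
      have := mul_le_mul_of_nonneg_left (le_weight (L := L) hn x) (by positivity : (0 : ℝ) ≤ n)
      refine le_trans (le_of_eq ?_) this
      field_simp
    rw [h3]
    nlinarith [mul_le_mul_of_nonneg_right h4 hm0.le]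
  have adj : ∀ x y, x ≠ 0 → y ≠ 0 → (dist (p x) (p y) ≤ 2 * R ↔
      ((x : ℝ) - y) ^ 2 + (weight L n x / m - weight L n y / m) ^ 2 ≤
        weight L n x * weight L n y) := fun x y hx hy => by
    rw [dist_le_two_mul_iff _ _ hR0.le, pre x hx, pre y hy, pim x hx, pim y hy, ← hm, cross]
  let G : SimpleGraph (Fin n) :=
    { Adj := fun u v => u ≠ v ∧ dist (p u) (p v) ≤ 2 * R
      symm := ⟨fun u v h => ⟨h.1.symm, by rw [_root_.dist_comm]; exact h.2⟩⟩
      loopless := ⟨fun u h => h.1 rfl⟩ }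
  refine ⟨G, ⟨hR0, fun v => p v, p 0, ?_, fun v => apex v v.2⟩, ?_, ?_, ?_, ?_⟩
  · intro u v
    rw [disks_inter_nonempty_iff]
  · intro u v hu hv
    refine ⟨fun h => hv (h ▸ hu), ?_⟩
    rw [hu]
    exact apex v v.2
  · intro u v hu hv h
    have := (adj _ _ hu hv).1 h.2
    nlinarith [sq_nonneg (weight L n u / m - weight L n v / m)]
  · intro u v hu hv huv hw h
    refine ⟨huv, (adj _ _ hu hv).2 ?_⟩
    -- Equal heights leave no error term; this matters because consecutive members of a level attain
    -- equality.
    rw [hw, sub_self]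
    rw [hw] at h
    linarith
  · intro u v hu hv huv h
    refine ⟨huv, (adj _ _ hu hv).2 ?_⟩
    have : (weight L n u / m - weight L n v / m) ^ 2 ≤ 1 := by
      rw [sq_le_one_iff_abs_le_one, abs_le]
      constructor <;> linarith [small u, pos u, small v, pos v]
    linarith

/-- The positive integers below `n` of a fixed 2-adic valuation `e ∈ L`. -/
def dyadicRow (L : Finset ℕ) (n e : ℕ) : Set (Fin n) :=
  {v | v.val ≠ 0 ∧ padicValNat 2 v.val = e ∧ e ∈ L}

/-- For every set `L` of levels there is a disk graph with a clique minor of order `L.card` and a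
dominating vertex, and whose cliques occupy only few levels. -/
theorem exists_dyadic_graph {n : ℕ} (hn : 4 ≤ n) {R : ℝ} (hR0 : 0 < R)
    (hR : 8 * (n : ℝ) ^ 2 ≤ 2 * Real.sinh R) {L : Finset ℕ} (hL : ∀ e ∈ L, 2 ^ e < n) :
    ∃ G : SimpleGraph (Fin n), IsSHUDG G R ∧ L.card ≤ treewidth G + 1 ∧
      treewidth G + 1 ≤ 3 * (rowTreewidth G + 1) ∧
      ∃ E ⊆ L, G.cliqueNum ≤ 2 * E.card + 2 ∧
        ∀ a ∈ E, ∀ b ∈ E, ∀ c ∈ E, a < b → b < c → 2 * b ≤ a + c + 4 := by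
  have hn' : (4 : ℝ) ≤ n := by exact_mod_cast hn
  obtain ⟨G, hG, hapex, hclose, heq, hadj⟩ := exists_weight_graph hn hR0 hR hL
  refine ⟨G, hG, ?_, ?_, ?_⟩
  · obtain ⟨D, hD⟩ := exists_width_eq_treewidth G
    rw [← hD]
    refine D.card_le_width_add_one L (dyadicRow L n) ?_ ?_ ?_ ?_
    · intro e
      by_cases he : e ∈ L
      · have hlt : 2 ^ e < n := hL e he
        have hb : (⟨2 ^ e, hlt⟩ : Fin n) ∈ dyadicRow L n e :=
          ⟨by simp, by simp, he⟩
        have reach : ∀ a (ha : 2 ^ e * (2 * a + 1) < n)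
            (hm : (⟨2 ^ e * (2 * a + 1), ha⟩ : Fin n) ∈ dyadicRow L n e),
            (G.induce (dyadicRow L n e)).Reachable ⟨_, hb⟩ ⟨_, hm⟩ := by
          intro a
          induction a with
          | zero =>
            intro ha hm
            have : (⟨⟨2 ^ e, hlt⟩, hb⟩ : dyadicRow L n e) =
                ⟨⟨2 ^ e * (2 * 0 + 1), ha⟩, hm⟩ := by
              ext; simp
            rw [this]
          | succ a ih =>
            intro ha hm
            have ha' : 2 ^ e * (2 * a + 1) < n := lt_of_le_of_lt (by gcongr; omega) ha
            have hm' : (⟨2 ^ e * (2 * a + 1), ha'⟩ : Fin n) ∈ dyadicRow L n e :=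
              ⟨by positivity, padicValNat_two_pow_mul_odd _ _, he⟩
            refine (ih ha' hm').trans (Adj.reachable ?_)
            have w1 : weight L n (2 ^ e * (2 * a + 1)) = 2 ^ (e + 1) := by
              have h := padicValNat_two_pow_mul_odd e a
              rw [weight_of_mem (by rwa [h]), h]
            have w2 : weight L n (2 ^ e * (2 * (a + 1) + 1)) = 2 ^ (e + 1) := by
              have h := padicValNat_two_pow_mul_odd e (a + 1)
              rw [weight_of_mem (by rwa [h]), h]
            refine heq ⟨_, ha'⟩ ⟨_, ha⟩ hm'.1 hm.1 ?_ (w1.trans w2.symm) ?_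
            · intro h
              have h' : 2 ^ e * (2 * a + 1) = 2 ^ e * (2 * (a + 1) + 1) := congrArg Fin.val h
              have := Nat.eq_of_mul_eq_mul_left (by positivity) h'
              omega
            · rw [w1, w2]
              push_cast
              apply le_of_eq
              ring
        have base : ∀ v : dyadicRow L n e,
            (G.induce (dyadicRow L n e)).Reachable ⟨_, hb⟩ v := by
          rintro ⟨⟨v, hv⟩, hm⟩
          obtain ⟨a, ha⟩ := exists_eq_two_pow_mul_odd hm.1
          have hve : padicValNat 2 v = e := hm.2.1
          simp only [hve] at ha
          subst ha
          exact reach a hv hm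
        exact fun u v => (base u).symm.trans (base v)
      · exact fun u => absurd u.2.2.2 he
    · intro i j v hi hj
      exact hi.2.1.symm.trans hj.2.1
    · intro e he
      exact ⟨⟨2 ^ e, hL e he⟩, by simp, by simp, he⟩
    · have main : ∀ i ∈ L, ∀ j ∈ L, j < i →
          ∃ u ∈ dyadicRow L n i, ∃ v ∈ dyadicRow L n j, G.Adj u v := by
        intro i hi j hj hji
        obtain ⟨d, rfl⟩ := Nat.exists_eq_add_of_lt hji
        have hlt := hL _ hi
        -- This `k` makes `2 ^ j * (2 * k + 1)` equal to `2 ^ (j + d + 1) - 2 ^ j`, an integer on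
        -- level `j` at distance `2 ^ j` from `2 ^ (j + d + 1)`.
        obtain ⟨k, hk⟩ : ∃ k, 2 ^ d = k + 1 := Nat.exists_eq_succ_of_ne_zero (by positivity)
        have hsum : 2 ^ j * (2 * k + 1) + 2 ^ j = 2 ^ (j + d + 1) := by
          rw [pow_succ, pow_add, hk]; ring
        have hpj : 0 < 2 ^ j := by positivity
        have hv := padicValNat_two_pow_mul_odd j k
        have hu : padicValNat 2 (2 ^ (j + d + 1)) = j + d + 1 := by simp
        refine ⟨⟨2 ^ (j + d + 1), hlt⟩, ⟨by simp, hu, hi⟩,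
          ⟨2 ^ j * (2 * k + 1), by omega⟩, ⟨by positivity, hv, hj⟩, ?_⟩
        refine hadj _ _ (by simp) (by positivity) ?_ ?_
        · intro h
          have h' : 2 ^ (j + d + 1) = 2 ^ j * (2 * k + 1) := congrArg Fin.val h
          omega
        · simp only
          rw [weight_of_mem (by rwa [hu]), weight_of_mem (by rwa [hv]), hu, hv]
          have hs : ((2 ^ (j + d + 1) : ℕ) : ℝ) - ((2 ^ j * (2 * k + 1) : ℕ) : ℝ) = 2 ^ j := by
            rw [← hsum]; push_cast; ring
          rw [hs]
          have h1 : (1 : ℝ) ≤ 2 ^ j := one_le_pow₀ (by norm_num)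
          have h2 : (2 : ℝ) ^ (j + 1) ≤ 2 ^ (j + d + 1 + 1) :=
            pow_le_pow_right₀ (by norm_num) (by omega)
          rw [pow_succ] at h2
          rw [pow_succ 2 j]
          nlinarith
      intro i hi j hj hij
      rcases lt_or_gt_of_ne hij with h | h
      · obtain ⟨u, hu, v, hv, huv⟩ := main j hj i hi h
        exact ⟨v, hv, u, hu, huv.symm⟩
      · exact main i hi j hj h
  · refine treewidth_add_one_le_of_dominating G ⟨0, by omega⟩ fun v hv => hapex _ v rfl ?_
    intro h
    exact hv (Fin.ext h)
  · obtain ⟨S, hS, hScard⟩ := G.exists_isNClique_cliqueNum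
    rw [← hScard]
    obtain ⟨T, hT⟩ : ∃ T, T = (S.image Fin.val).erase 0 := ⟨_, rfl⟩
    have hST : S.card ≤ T.card + 1 := by
      rw [← Finset.card_image_of_injective S Fin.val_injective, hT]
      have := Finset.pred_card_le_card_erase (s := S.image Fin.val) (a := 0)
      omega
    have h0 : 0 ∉ T := by rw [hT]; simp
    have hTw : ∀ x ∈ T, ∀ y ∈ T, x ≠ y → ((x : ℝ) - y) ^ 2 ≤ weight L n x * weight L n y := by
      intro x hx y hy hxy
      rw [hT, Finset.mem_erase, Finset.mem_image] at hx hy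
      obtain ⟨hx0, u, hu, rfl⟩ := hx
      obtain ⟨hy0, v, hv, rfl⟩ := hy
      exact hclose u v hx0 hy0 (hS hu hv fun h => hxy (congrArg _ h))
    by_cases hcard : T.card ≤ 1
    -- The summand `2` in the clique bound covers this case: the origin and one integer, possibly of
    -- a level outside `L`.
    · exact ⟨∅, by simp, by simpa using by omega, by simp⟩
    -- A negligible weight times any other is at most `1 / 2`, less than the squared distance of two
    -- distinct integers.
    have hTL : ∀ x ∈ T, padicValNat 2 x ∈ L := by
      intro x hx
      by_contra hxL
      obtain ⟨y, hy, hyx⟩ := Finset.exists_mem_ne (not_le.1 hcard) x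
      have h1 := hTw x hx y hy hyx.symm
      have h2 : weight L n x = 1 / (4 * n) := if_neg hxL
      have h3 : weight L n x * weight L n y ≤ 1 / 2 := by
        rw [h2]
        calc 1 / (4 * (n : ℝ)) * weight L n y ≤ 1 / (4 * n) * (2 * n) :=
              mul_le_mul_of_nonneg_left (weight_le hn hL y) (by positivity)
          _ = 1 / 2 := by field_simp; norm_num
      have h4 : (1 : ℤ) ≤ ((x : ℤ) - y) ^ 2 := by
        have : ((x : ℤ) - y) ≠ 0 := by omega
        have := sq_pos_of_ne_zero this
        omega
      have h5 : (1 : ℝ) ≤ ((x : ℝ) - y) ^ 2 := by exact_mod_cast h4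
      linarith
    have hTc : ∀ x ∈ T, ∀ y ∈ T, x ≠ y → DyadicClose x y := by
      intro x hx y hy hxy
      have h := hTw x hx y hy hxy
      rw [weight_of_mem (hTL x hx), weight_of_mem (hTL y hy)] at h
      unfold DyadicClose
      exact_mod_cast h
    refine ⟨T.image (padicValNat 2), ?_, ?_, ?_⟩
    · intro e he
      obtain ⟨x, hx, rfl⟩ := Finset.mem_image.1 he
      exact hTL x hx
    · have := card_le_two_mul_card_image_padicValNat h0 hTc
      omega
    · intro a ha b hb c hc hab hbc
      obtain ⟨x, hx, rfl⟩ := Finset.mem_image.1 ha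
      obtain ⟨y, hy, rfl⟩ := Finset.mem_image.1 hb
      obtain ⟨z, hz, rfl⟩ := Finset.mem_image.1 hc
      have ne0 : ∀ {x}, x ∈ T → x ≠ 0 := fun hx h => h0 (h ▸ hx)
      refine two_mul_le_of_dyadicClose (ne0 hy) (ne0 hz) hbc
        (hTc x hx y hy ?_) (hTc x hx z hz ?_)
      · rintro rfl; exact hab.ne rfl
      · rintro rfl; exact (hab.trans hbc).ne rfl

/-! ### Families of disk graphs with prescribed radii -/

/-- The radius bound gives `exp R ≥ n ^ 4 ≥ 16 * n ^ 2`, and `exp (-R) ≤ 1` is absorbed by the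
slack. -/
theorem eight_mul_sq_le_two_mul_sinh {n : ℕ} (hn : 4 ≤ n) {R : ℝ} (hR : 4 * Real.log n ≤ R) :
    8 * (n : ℝ) ^ 2 ≤ 2 * Real.sinh R := by
  have hn' : (4 : ℝ) ≤ n := by exact_mod_cast hn
  have hlog : 0 ≤ Real.log n := Real.log_nonneg (by linarith)
  have h1 : (n : ℝ) ^ 4 ≤ Real.exp R := by
    rw [← Real.log_le_iff_le_exp (by positivity), Real.log_pow]
    exact_mod_cast hR
  have h2 : Real.exp (-R) ≤ 1 := Real.exp_le_one_iff.2 (by linarith)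
  have h3 : (16 : ℝ) ≤ (n : ℝ) ^ 2 := by nlinarith
  rw [Real.sinh_eq]
  nlinarith

/-- Graphs that exist for all radii of at least `4 * log n` form a family with radii in `Θ(r)`. -/
theorem exists_family {r : ℕ → ℝ}
    (hr : ∃ c : ℝ, 0 < c ∧ ∀ᶠ n : ℕ in Filter.atTop, c * Real.log n ≤ r n)
    {P : ∀ n : ℕ, SimpleGraph (Fin n) → Prop}
    (h : ∀ n : ℕ, 4 ≤ n → ∀ R : ℝ, 4 * Real.log n ≤ R →
      ∃ G : SimpleGraph (Fin n), IsSHUDG G R ∧ P n G) :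
    ∃ (G : (n : ℕ) → SimpleGraph (Fin n)) (R : ℕ → ℝ), (∀ n, IsSHUDG (G n) (R n)) ∧
      (∃ c₁ c₂ : ℝ, 0 < c₁ ∧ 0 < c₂ ∧
        ∀ᶠ n : ℕ in Filter.atTop, c₁ * r n ≤ R n ∧ R n ≤ c₂ * r n) ∧
      ∀ᶠ n : ℕ in Filter.atTop, P n (G n) := by
  classical
  obtain ⟨c, hc, hcr⟩ := hr
  have key : ∀ n : ℕ, ∃ (G : SimpleGraph (Fin n)) (R : ℝ), IsSHUDG G R ∧
      (4 ≤ n ∧ c * Real.log n ≤ r n → R = 4 / c * r n ∧ P n G) := by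
    intro n
    by_cases hn : 4 ≤ n ∧ c * Real.log n ≤ r n
    · obtain ⟨G, hG, hP⟩ := h n hn.1 (4 / c * r n) (by
        rw [div_mul_eq_mul_div, le_div_iff₀ hc]
        linarith [hn.2])
      exact ⟨G, _, hG, fun _ => ⟨rfl, hP⟩⟩
    -- For the remaining `n`, which are finitely many, any disk graph will do: all centers coincide.
    · refine ⟨⊤, 1, ⟨one_pos, fun _ => UpperHalfPlane.I, UpperHalfPlane.I, ?_, ?_⟩,
        fun h => absurd h hn⟩
      · intro u v
        rw [disks_inter_nonempty_iff]
        simp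
      · simp
  choose G R hG hGR using key
  have hev : ∀ᶠ n : ℕ in Filter.atTop, 4 ≤ n ∧ c * Real.log n ≤ r n :=
    (Filter.eventually_ge_atTop 4).and hcr
  refine ⟨G, R, hG, ⟨4 / c, 4 / c, by positivity, by positivity, ?_⟩, ?_⟩
  · filter_upwards [hev] with n hn
    rw [(hGR n hn).1]
    exact ⟨le_rfl, le_rfl⟩
  · filter_upwards [hev] with n hn
    exact (hGR n hn).2

theorem two_pow_lt_of_le_log_sub_one {n e : ℕ} (hn : 4 ≤ n) (he : e ≤ Nat.log 2 n - 1) :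
    2 ^ e < n := by
  have h1 : 0 < Nat.log 2 n := Nat.log_pos (by norm_num) (by omega)
  calc 2 ^ e < 2 ^ Nat.log 2 n := Nat.pow_lt_pow_right (by norm_num) (by omega)
    _ ≤ n := Nat.pow_log_le_self 2 (by omega)

/-- Using all levels gives logarithmic treewidth. -/
theorem exists_graph_log {n : ℕ} (hn : 4 ≤ n) {R : ℝ} (hR : 4 * Real.log n ≤ R) :
    ∃ G : SimpleGraph (Fin n), IsSHUDG G R ∧
      G.cliqueNum ≤ 2 * Nat.log 2 (Nat.log 2 n) + 14 ∧
      Nat.log 2 n - 1 ≤ treewidth G ∧ Nat.log 2 n ≤ 3 * (rowTreewidth G + 1) := by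
  have hR0 : 0 < R := lt_of_lt_of_le
    (mul_pos (by norm_num) (Real.log_pos (by exact_mod_cast (by omega : 1 < n)))) hR
  obtain ⟨G, hG, htw, hrtw, E, hE, hcl, hEd⟩ := exists_dyadic_graph hn hR0
    (eight_mul_sq_le_two_mul_sinh hn hR) (L := Finset.range (Nat.log 2 n - 1 + 1))
    (fun e he => two_pow_lt_of_le_log_sub_one hn (by rw [Finset.mem_range] at he; omega))
  rw [Finset.card_range] at htw
  refine ⟨G, hG, ?_, by omega, by omega⟩
  have := card_le_log_of_doubling (K := Nat.log 2 n)
    (fun e he => by have := Finset.mem_range.1 (hE he); omega) hEd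
  omega

/-- Using exponentially spaced levels gives doubly logarithmic treewidth. -/
theorem exists_graph_log_log {n : ℕ} (hn : 4 ≤ n) {R : ℝ} (hR : 4 * Real.log n ≤ R) :
    ∃ G : SimpleGraph (Fin n), IsSHUDG G R ∧ G.cliqueNum ≤ 6 ∧
      Nat.log 4 (Nat.log 2 n - 1) ≤ treewidth G ∧
      Nat.log 4 (Nat.log 2 n - 1) ≤ 3 * (rowTreewidth G + 1) := by
  have hR0 : 0 < R := lt_of_lt_of_le
    (mul_pos (by norm_num) (Real.log_pos (by exact_mod_cast (by omega : 1 < n)))) hR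
  have hK : 1 ≤ Nat.log 2 n - 1 := by
    have : Nat.log 2 4 ≤ Nat.log 2 n := Nat.log_mono_right hn
    have h4 : Nat.log 2 4 = 2 := Nat.log_pow (by norm_num) 2
    omega
  have hlt := fun e => two_pow_lt_of_le_log_sub_one (e := e) hn
  generalize Nat.log 2 n - 1 = K at *
  have hpow : ∀ s ∈ Finset.range (Nat.log 4 K + 1), 4 ^ s ≤ K := fun s hs =>
    Nat.pow_le_of_le_log (by omega) (Nat.lt_succ_iff.1 (Finset.mem_range.1 hs))
  have hinj : Set.InjOn (fun s => K - 4 ^ s) (Finset.range (Nat.log 4 K + 1)) := by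
    intro s hs t ht h
    have h1 := hpow s hs
    have h2 := hpow t ht
    simp only at h
    exact Nat.pow_right_injective (by norm_num : 2 ≤ 4)
      (show 4 ^ s = 4 ^ t by omega)
  obtain ⟨G, hG, htw, hrtw, E, hE, hcl, hEd⟩ := exists_dyadic_graph hn hR0
    (eight_mul_sq_le_two_mul_sinh hn hR)
    (L := (Finset.range (Nat.log 4 K + 1)).image fun s => K - 4 ^ s)
    (fun e he => hlt e (by
      obtain ⟨s, -, rfl⟩ := Finset.mem_image.1 he
      exact Nat.sub_le _ _))
  rw [Finset.card_image_of_injOn hinj, Finset.card_range] at htw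
  refine ⟨G, hG, ?_, by omega, by omega⟩
  -- For levels `K - 4 ^ s < K - 4 ^ t < K - 4 ^ u`, the triple inequality reads `4 ^ s + 4 ^ u ≤ 2
  -- * 4 ^ t + 4`. This contradicts `4 ^ s ≥ 4 * 4 ^ t` and `4 ^ t ≥ 4`.
  have hgap : ∀ s t, 4 ^ t < 4 ^ s → 4 * 4 ^ t ≤ 4 ^ s := by
    intro s t h
    rw [Nat.pow_lt_pow_iff_right (by norm_num)] at h
    calc 4 * 4 ^ t = 4 ^ (t + 1) := by ring
      _ ≤ 4 ^ s := Nat.pow_le_pow_right (by norm_num) h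
  have := card_le_two_of_no_lt_lt (E := E) (by
    intro a ha b hb c hc hab hbc
    have h := hEd a ha b hb c hc hab hbc
    obtain ⟨s, hs, rfl⟩ := Finset.mem_image.1 (hE ha)
    obtain ⟨t, ht, rfl⟩ := Finset.mem_image.1 (hE hb)
    obtain ⟨u, hu, rfl⟩ := Finset.mem_image.1 (hE hc)
    have h1 := hpow s hs
    have h2 := hgap s t (by omega)
    have h3 := hgap t u (by omega)
    have h4 : 0 < 4 ^ u := by positivity
    omega)
  omega

/-! ### Comparison of logarithms -/

theorem log_le_natLog_add_one {n : ℕ} : Real.log n ≤ Nat.log 2 n + 1 := by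
  rcases n.eq_zero_or_pos with rfl | hn
  · simp
  have h : (n : ℝ) ≤ 2 ^ (Nat.log 2 n + 1) := by
    exact_mod_cast (Nat.lt_pow_succ_log_self (by norm_num) n).le
  have h2 := Real.log_le_log (by exact_mod_cast hn) h
  rw [Real.log_pow] at h2
  push_cast at h2
  have h3 : Real.log 2 ≤ 1 := by linarith [Real.log_two_lt_d9]
  nlinarith [(Nat.cast_nonneg (Nat.log 2 n) : (0 : ℝ) ≤ _)]

theorem natLog_le_two_mul_log {n : ℕ} (hn : n ≠ 0) : (Nat.log 2 n : ℝ) ≤ 2 * Real.log n := by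
  have h : (2 : ℝ) ^ Nat.log 2 n ≤ n := by exact_mod_cast Nat.pow_log_le_self 2 hn
  have h2 := Real.log_le_log (by positivity) h
  rw [Real.log_pow] at h2
  nlinarith [Real.log_two_gt_d9, (Nat.cast_nonneg (Nat.log 2 n) : (0 : ℝ) ≤ _)]

theorem log_le_two_mul_natLog_four {n : ℕ} : Real.log n ≤ 2 * (Nat.log 4 n + 1) := by
  rcases n.eq_zero_or_pos with rfl | hn
  · simp
  have h : (n : ℝ) ≤ 4 ^ (Nat.log 4 n + 1) := by
    exact_mod_cast (Nat.lt_pow_succ_log_self (by norm_num) n).le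
  have h2 := Real.log_le_log (by exact_mod_cast hn) h
  rw [Real.log_pow, show (4 : ℝ) = 2 ^ 2 by norm_num, Real.log_pow] at h2
  push_cast at h2
  nlinarith [Real.log_two_lt_d9, (Nat.cast_nonneg (Nat.log 4 n) : (0 : ℝ) ≤ _)]

theorem eventually_le_log (B : ℝ) : ∀ᶠ n : ℕ in Filter.atTop, B ≤ Real.log n :=
  (Real.tendsto_log_atTop.comp tendsto_natCast_atTop_atTop).eventually_ge_atTop B

theorem eventually_le_log_log (B : ℝ) : ∀ᶠ n : ℕ in Filter.atTop, B ≤ Real.log (Real.log n) :=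
  (Real.tendsto_log_atTop.comp
    (Real.tendsto_log_atTop.comp tendsto_natCast_atTop_atTop)).eventually_ge_atTop B

end DiskGraph

theorem mainTheorem8 (r : ℕ → ℝ)
    (hr : ∃ c : ℝ, 0 < c ∧ ∀ᶠ n : ℕ in Filter.atTop, c * Real.log n ≤ r n) :
    (∃ (G : (n : ℕ) → SimpleGraph (Fin n)) (R : ℕ → ℝ),
      (∀ n, DiskGraph.IsSHUDG (G n) (R n)) ∧
      (∃ c₁ c₂ : ℝ, 0 < c₁ ∧ 0 < c₂ ∧
        ∀ᶠ n : ℕ in Filter.atTop, c₁ * r n ≤ R n ∧ R n ≤ c₂ * r n) ∧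
      (∃ C : ℝ, 0 < C ∧ ∀ᶠ n : ℕ in Filter.atTop,
        ((G n).cliqueNum : ℝ) ≤ C * Real.log (Real.log n)) ∧
      (∃ c : ℝ, 0 < c ∧ ∀ᶠ n : ℕ in Filter.atTop,
        c * Real.log n ≤ (DiskGraph.treewidth (G n) : ℝ) ∧
        c * Real.log n ≤ (DiskGraph.rowTreewidth (G n) : ℝ))) ∧
    (∃ (G : (n : ℕ) → SimpleGraph (Fin n)) (R : ℕ → ℝ),
      (∀ n, DiskGraph.IsSHUDG (G n) (R n)) ∧
      (∃ c₁ c₂ : ℝ, 0 < c₁ ∧ 0 < c₂ ∧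
        ∀ᶠ n : ℕ in Filter.atTop, c₁ * r n ≤ R n ∧ R n ≤ c₂ * r n) ∧
      (∃ C : ℝ, 0 < C ∧ ∀ᶠ n : ℕ in Filter.atTop, ((G n).cliqueNum : ℝ) ≤ C) ∧
      (∃ c : ℝ, 0 < c ∧ ∀ᶠ n : ℕ in Filter.atTop,
        c * Real.log (Real.log n) ≤ (DiskGraph.treewidth (G n) : ℝ) ∧
        c * Real.log (Real.log n) ≤ (DiskGraph.rowTreewidth (G n) : ℝ))) := by
  constructor
  · obtain ⟨G, R, hG, hR, hP⟩ := DiskGraph.exists_family hr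
      fun n hn R hR => DiskGraph.exists_graph_log hn hR
    -- The constant `1 / 6` comes from `(log n - 1) / 3 - 1 ≥ log n / 6`, valid once `log n ≥ 8`;
    -- the constant `20` is generous.
    refine ⟨G, R, hG, hR, ⟨20, by norm_num, ?_⟩, 1 / 6, by norm_num, ?_⟩
    · filter_upwards [hP, DiskGraph.eventually_le_log 2, DiskGraph.eventually_le_log_log 2,
        Filter.eventually_ge_atTop 4] with n hP hlog hll hn
      have h1 : ((G n).cliqueNum : ℝ) ≤ 2 * Nat.log 2 (Nat.log 2 n) + 14 := by
        exact_mod_cast hP.1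
      have hpos : 0 < Nat.log 2 n := Nat.log_pos (by norm_num) (by omega)
      have h2 := DiskGraph.natLog_le_two_mul_log hpos.ne'
      have h3 := DiskGraph.natLog_le_two_mul_log (show n ≠ 0 by omega)
      have h4 := Real.log_le_log (by exact_mod_cast hpos) h3
      rw [Real.log_mul (by norm_num) (by linarith)] at h4
      linarith [Real.log_two_lt_d9]
    · filter_upwards [hP, DiskGraph.eventually_le_log 8] with n hP hlog
      have h1 := DiskGraph.log_le_natLog_add_one (n := n)
      have h2 : (Nat.log 2 n : ℝ) ≤ DiskGraph.treewidth (G n) + 1 := by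
        exact_mod_cast (show Nat.log 2 n ≤ DiskGraph.treewidth (G n) + 1 by omega)
      have h3 : (Nat.log 2 n : ℝ) ≤ 3 * (DiskGraph.rowTreewidth (G n) + 1) := by
        exact_mod_cast hP.2.2
      constructor <;> linarith
  · obtain ⟨G, R, hG, hR, hP⟩ := DiskGraph.exists_family hr
      fun n hn R hR => DiskGraph.exists_graph_log_log hn hR
    refine ⟨G, R, hG, hR, ⟨6, by norm_num, ?_⟩, 1 / 12, by norm_num, ?_⟩
    · filter_upwards [hP] with n hP
      exact_mod_cast hP.1
    · filter_upwards [hP, DiskGraph.eventually_le_log 4, DiskGraph.eventually_le_log_log 20]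
        with n hP hlog hll
      have h1 := DiskGraph.log_le_natLog_add_one (n := n)
      have h2 : (Nat.log 2 n : ℝ) ≤ (Nat.log 2 n - 1 : ℕ) + 1 := by
        exact_mod_cast (show Nat.log 2 n ≤ Nat.log 2 n - 1 + 1 by omega)
      -- Halving absorbs the loss of `2` once `log n ≥ 4`, and costs only an additive `log 2` in the
      -- iterated logarithm.
      have h3 : Real.log n / 2 ≤ (Nat.log 2 n - 1 : ℕ) := by linarith
      have h4 := Real.log_le_log (by linarith) h3
      rw [Real.log_div (by linarith) (by norm_num)] at h4
      have h5 := DiskGraph.log_le_two_mul_natLog_four (n := Nat.log 2 n - 1)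
      have h6 : (Nat.log 4 (Nat.log 2 n - 1) : ℝ) ≤ DiskGraph.treewidth (G n) := by
        exact_mod_cast hP.2.1
      have h7 : (Nat.log 4 (Nat.log 2 n - 1) : ℝ) ≤
          3 * (DiskGraph.rowTreewidth (G n) + 1) := by
        exact_mod_cast hP.2.2
      have h8 := Real.log_two_lt_d9
      constructor <;> linarith
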